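/- **Setting.** Let $A\in\mathbb R^{d\times d}$ be invertible, $\Lambda=A\mathbb Z^d$ the full lattice it generates, $\Lambda^*=A^{-T}\mathbb Z^d$ its dual lattice and $\Pi_\Lambda=A[0,1)^d$ its fundamental domain. A Lebesgue measurable set $\Omega\subset\mathbb R^d$ with $0<|\Omega|<\infty$ is a *$k$-tile* for $\Lambda$ if $\sum_{\lambda\in\Lambda}\chi_\Omega(x-\lambda)=k$ for almost every $x\in\mathbb R^d$. For $x\in\Pi_\Lambda$ put $\Lambda_x=\{\lambda\in\Lambda: x+\lambda\in\Omega\}$, which has $k$ elements for almost every $x$. For a finite set $M\subset\mathbb R^d$ let $M^l\subset\mathbb R^l$ be its projection to the first $l$ coordinates (with $M^0$ the one point of $\mathbb R^0$ if $M\neq\emptyset$), and for $p\in M^{l-1}$ let $Z^l_p=\{z\in\mathbb R:(p,z)\in M^l\}$. *Weak admissibility.* For $v\in\mathbb R^d$ and $q\in\mathbb Z_+^d$, a $k$-tile $\Omega$ is weakly $(v,q)$-admissible if for almost every $x\in\Pi_\Lambda$, with $M=\Lambda_x$, the following holds: for all $1\le l\le d$ and all $p\in M^{l-1}$ the real numbers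 $v_lz$, $z\in Z^l_p$, are distinct modulo $q_l$. *Shift index sets.* For a nonempty finite $M\subset\mathbb R^l$ a shift index set $K^l(M)\subset\{0,1,2,\dots\}^l$ is defined recursively. For $l=1$, $K^1(M)=\{0,\dots,\#M-1\}$. For $l\ge2$, enumerate $M^{l-1}=\{m_1,\dots,m_n\}$ without repetition so that $\#Z^l_{m_1}\le\dots\le\#Z^l_{m_n}$, and set $$K^l(M)=\bigcup_{i=1}^{n}K^{l-1}(\{m_i,m_{i+1},\dots,m_n\})\times Q_i,\qquad Q_1=\{0,\dots,\#Z^l_{m_1}-1\},\quad Q_i=\{\#Z^l_{m_{i-1}},\dots,\#Z^l_{m_i}-1\}\ (i\ge2).$$ Ties in the enumerations may be broken arbitrarily, so $M$ can have several shift index sets. **Theorem.** Let $\Omega\subset\mathbb R^d$ be a $k$-tile for $\Lambda$ that is weakly $(v,q)$-admissible for some $v\in\mathbb R^d$, $q\in\mathbb Z_+^d$. Let $\delta$ be the diagonal matrix with $\delta_{ll}=v_l/q_l$. Then: 1. For almost every $x\in\Pi_\Lambda$ shift index sets of $\Lambda_x$ exist, and each of them has exactly $k$ elements. 2. For every $\eta\in\Lambda^*$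 and for almost every $y\in\Omega$, $f(y)$ is uniquely determined from the data $$\{\langle f,e_l\rangle\}_{l\in L},\qquad L=\bigcup_{j\in K}(\Lambda^*+\delta j+\eta),\qquad e_l(t)=e^{2\pi i\,l\cdot t},\quad \langle f,e_l\rangle=\int_\Omega f\,\overline{e_l},$$ where $K$ is any shift index set of $\Lambda_x$ and $x$ is the representative of $y$ in $\Pi_\Lambda$ (that is, $x\in\Pi_\Lambda$ and $y-x\in\Lambda$). Precisely: there is a rule $R$, depending only on $\Omega$, $A$, $v$, $q$, $\eta$, such that for every $f\in L^2(\Omega)$ and almost every $y\in\Omega$ one has $f(y)=R\bigl(y,L,(\langle f,e_l\rangle)_{l\in L}\bigr)$ for all such $L$. In particular, if $f,g\in L^2(\Omega)$, then for almost every $y\in\Omega$ the equality of the data of $f$ and $g$ on one such $L$ implies $f(y)=g(y)$. -/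

import Mathlib

open MeasureTheory
open scoped Matrix ENNReal

namespace MultiTile

noncomputable section

/-- The full lattice `Λ = A ℤ^d` (for an invertible matrix `A`). -/
def lattice {d : ℕ} (A : Matrix (Fin d) (Fin d) ℝ) : Set (Fin d → ℝ) :=
  {y | ∃ z : Fin d → ℤ, y = A *ᵥ (fun i => (z i : ℝ))}

/-- The dual lattice `Λ* = A^{-T} ℤ^d`. -/
def dualLattice {d : ℕ} (A : Matrix (Fin d) (Fin d) ℝ) : Set (Fin d → ℝ) :=
  {y | ∃ z : Fin d → ℤ, y = (A⁻¹)ᵀ *ᵥ (fun i => (z i : ℝ))}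

/-- The fundamental domain `Π_Λ = A [0,1)^d`. -/
def fundDomain {d : ℕ} (A : Matrix (Fin d) (Fin d) ℝ) : Set (Fin d → ℝ) :=
  {y | ∃ t : Fin d → ℝ, (∀ i, t i ∈ Set.Ico (0 : ℝ) 1) ∧ y = A *ᵥ t}

/-- `Ω` is a `k`-tile for `Λ = A ℤ^d`: a Lebesgue measurable set of finite positive measure with
`∑_{λ ∈ Λ} χ_Ω (x - λ) = k` for almost every `x`. -/
structure IsMultiTile {d : ℕ} (A : Matrix (Fin d) (Fin d) ℝ) (Ω : Set (Fin d → ℝ)) (k : ℕ) :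
    Prop where
  nullMeasurable : NullMeasurableSet Ω volume
  pos : 0 < volume Ω
  finite : volume Ω < ∞
  tile : ∀ᵐ x : Fin d → ℝ, ∑' l : lattice A, Ω.indicator (fun _ => (1 : ℝ≥0∞)) (x - l) = k

/-- The frequency set `Λ_x = {λ ∈ Λ | x + λ ∈ Ω}`. -/
def freqSet {d : ℕ} (A : Matrix (Fin d) (Fin d) ℝ) (Ω : Set (Fin d → ℝ)) (x : Fin d → ℝ) :
    Set (Fin d → ℝ) :=
  {y | y ∈ lattice A ∧ x + y ∈ Ω}

/-- The projection of a set of vectors in `ℝ^d` to the first `l` coordinates. -/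
def proj {d : ℕ} (M : Set (Fin d → ℝ)) (l : ℕ) (h : l ≤ d) : Set (Fin l → ℝ) :=
  (fun m i => m (Fin.castLE h i)) '' M

/-- The last coordinates of those vectors of `N` that extend the vector `p`:
`{z ∈ ℝ | (p, z) ∈ N}`. -/
def children {l : ℕ} (N : Set (Fin (l + 1) → ℝ)) (p : Fin l → ℝ) : Set ℝ :=
  {z | (Fin.snoc p z : Fin (l + 1) → ℝ) ∈ N}

/-- The condition on a frequency set `M` in the definition of weak `(v, q)`-admissibility: for each
coordinate `l` and each `p` in the projection of `M` to the coordinates before `l`, the numbers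
`v_l z`, with `(p, z)` in the projection of `M` to the coordinates up to `l`, are distinct
modulo `q_l`. -/
def DistinctMod {d : ℕ} (v : Fin d → ℝ) (q : Fin d → ℕ) (M : Set (Fin d → ℝ)) : Prop :=
  ∀ (l : ℕ) (h : l < d), ∀ p ∈ proj M l h.le,
    Set.InjOn (fun z : ℝ => ((v ⟨l, h⟩ * z : ℝ) : AddCircle (q ⟨l, h⟩ : ℝ)))
      (children (proj M (l + 1) h) p)

/-- `Ω` is weakly `(v, q)`-admissible for `Λ = A ℤ^d`. -/
def WeaklyAdmissible {d : ℕ} (A : Matrix (Fin d) (Fin d) ℝ) (Ω : Set (Fin d → ℝ))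
    (v : Fin d → ℝ) (q : Fin d → ℕ) : Prop :=
  ∀ᵐ x ∂(volume.restrict (fundDomain A)), DistinctMod v q (freqSet A Ω x)

/-- For cardinalities `c 0 ≤ c 1 ≤ …`, the index blocks `Q_0 = {0, …, c 0 - 1}` and
`Q_i = {c (i-1), …, c i - 1}` for `i ≥ 1`. -/
def block {n : ℕ} (c : Fin n → ℕ) (i : Fin n) : Set ℕ :=
  {t | t < c i ∧ ∀ i' : Fin n, (i' : ℕ) + 1 = i → c i' ≤ t}

/-- `IsShiftIndexSet l M K`: `K ⊆ ℕ^l` is a shift index set `K^l(M)` of the finite set `M ⊆ ℝ^l`.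
The projection of `M` to the first coordinates is enumerated as `m_0, …, m_{n-1}` so that
the number of children does not decrease, and `K` is the union of the products
`K^{l-1}({m_i, …, m_{n-1}}) × Q_i`, where each `K^{l-1}({m_i, …, m_{n-1}})` is again a shift index
set. Ties in the enumeration may be broken in any way, at each stage of the recursion. The
recursion starts with the one-point space `ℝ^0`; hence for `l = 1` the projection of a nonempty `M`
is one point, all elements of `M` are its children, and `K = {0, …, #M - 1}`. -/
def IsShiftIndexSet : (l : ℕ) → Set (Fin l → ℝ) → Set (Fin l → ℕ) → Prop
  | 0, M, K => K = {_j | M.Nonempty}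
  | l + 1, M, K =>
      ∃ (n : ℕ) (m : Fin n → (Fin l → ℝ)) (K' : Fin n → Set (Fin l → ℕ)),
        Function.Injective m ∧
        Set.range m = proj M l (Nat.le_succ l) ∧
        Monotone (fun i => (children M (m i)).ncard) ∧
        (∀ i, IsShiftIndexSet l (m '' Set.Ici i) (K' i)) ∧
        K = ⋃ i, {j : Fin (l + 1) → ℕ | (Fin.init j : Fin l → ℕ) ∈ K' i ∧
          j (Fin.last l) ∈ block (fun i' => (children M (m i')).ncard) i}

/-- The lattice shift `a = δ j + η`, where `δ` is the diagonal matrix with `δ_ll = v_l / q_l`. -/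
def latticeShift {d : ℕ} (v : Fin d → ℝ) (q : Fin d → ℕ) (η : Fin d → ℝ) (j : Fin d → ℕ) :
    Fin d → ℝ :=
  Matrix.diagonal (fun l => v l / (q l : ℝ)) *ᵥ (fun l => (j l : ℝ)) + η

/-- The set of frequencies `L = ⋃_{j ∈ K} (Λ* + δ j + η)`. -/
def dataFrequencies {d : ℕ} (A : Matrix (Fin d) (Fin d) ℝ) (v : Fin d → ℝ) (q : Fin d → ℕ)
    (η : Fin d → ℝ) (K : Set (Fin d → ℕ)) : Set (Fin d → ℝ) :=
  ⋃ j ∈ K, {y | ∃ u ∈ dualLattice A, y = u + latticeShift v q η j}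

/-- The exponential `e_l(x) = e^{2πi l·x}`. -/
def expFun {d : ℕ} (l x : Fin d → ℝ) : ℂ :=
  Complex.exp (2 * (Real.pi : ℂ) * Complex.I * ((l ⬝ᵥ x : ℝ) : ℂ))

/-- The datum `⟨f, e_l⟩`, the inner product in `L²(Ω)` (conjugate linear in the second entry). -/
def datum {d : ℕ} (Ω : Set (Fin d → ℝ)) (f : (Fin d → ℝ) → ℂ) (l : Fin d → ℝ) : ℂ :=
  ∫ x in Ω, f x * (starRingEnd ℂ) (expFun l x)

end

end MultiTile

namespace MultiTile

open Filter Topology ComplexConjugate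

/-! Fix a shift `a`. Up to normalization, the numbers `⟨f, e_{u+a}⟩`, `u ∈ Λ*`, are the Fourier
coefficients of the `Λ`-periodization of `χ_Ω f conj(e_a)`. So for almost every `x` they determine
the finite sum of `f(x+m) conj(e_a(x+m))` over `m ∈ Λ_x` (`ae_tsum_lattice_eq_zero`). For `a = δj +
η`, `j ∈ K`, these sums give, after removal of a nonzero factor, a linear system in the unknowns
`f(x+m) conj(e_η(x+m))` with matrix entries `∏ w_i(m_i)^{j_i}`, where `w_i(z) = exp(-2πi v_i z /
q_i)`.

View `Λ_x` as a tree whose levels are its projections. Weak admissibility says that `w_i` separates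
siblings, which makes this generalized Vandermonde system nonsingular
(`eq_zero_of_isShiftIndexSet`). The parents are treated in order of increasing number of children.
If `m_i` has `s` children, each exponent `t < s` of the last variable lies in some block `Q_{i₀}`
with `i₀ ≤ i`. The parents before `m_{i₀}` already contribute zero, and the result in one dimension
less, for `{m_{i₀}, …, m_n}`, isolates the `t`-th moment over the children of `m_i`. The moments for
all `t < s` form an ordinary Vandermonde system.

Hence the data for `K` determine `f` almost everywhere on the points whose `Λ_x` has shift index set
`K`. There are countably many finite `K`, so one null set (for given `f`) serves them all, and `R`
may evaluate any chosen `L²` function with the given data. -/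

/-! ### Fibres of a finite set over its projection, and blocks of exponents -/

theorem mem_proj_succ {l : ℕ} {M : Set (Fin (l + 1) → ℝ)} {p : Fin l → ℝ} :
    p ∈ proj M l (Nat.le_succ l) ↔ ∃ m ∈ M, (Fin.init m : Fin l → ℝ) = p := Iff.rfl

/-- The last coordinates of the vectors of a finite set `M` that extend `p`. -/
noncomputable def childFinset {l : ℕ} (M : Finset (Fin (l + 1) → ℝ)) (p : Fin l → ℝ) : Finset ℝ :=
  open Classical in (M.filter fun m => (Fin.init m : Fin l → ℝ) = p).image fun m => m (Fin.last l)

theorem mem_childFinset {l : ℕ} {M : Finset (Fin (l + 1) → ℝ)} {p : Fin l → ℝ} {z : ℝ} :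
    z ∈ childFinset M p ↔ (Fin.snoc p z : Fin (l + 1) → ℝ) ∈ M := by
  classical
  simp only [childFinset, Finset.mem_image, Finset.mem_filter]
  constructor
  · rintro ⟨m, ⟨hm, rfl⟩, rfl⟩
    simpa using hm
  · intro h
    exact ⟨_, ⟨h, by simp⟩, by simp⟩

theorem coe_childFinset {l : ℕ} (M : Finset (Fin (l + 1) → ℝ)) (p : Fin l → ℝ) :
    (childFinset M p : Set ℝ) = children (M : Set (Fin (l + 1) → ℝ)) p := by
  ext z
  simp [mem_childFinset, children]

theorem ncard_children {l : ℕ} (M : Finset (Fin (l + 1) → ℝ)) (p : Fin l → ℝ) :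
    (children (M : Set (Fin (l + 1) → ℝ)) p).ncard = (childFinset M p).card := by
  rw [← coe_childFinset, Set.ncard_coe_finset]

theorem sum_eq_sum_childFinset {l n : ℕ} {R : Type*} [AddCommMonoid R]
    (M : Finset (Fin (l + 1) → ℝ)) {m : Fin n → Fin l → ℝ} (hm : Function.Injective m)
    (hr : Set.range m = proj (M : Set (Fin (l + 1) → ℝ)) l (Nat.le_succ l))
    (f : (Fin (l + 1) → ℝ) → R) :
    ∑ x ∈ M, f x = ∑ i, ∑ z ∈ childFinset M (m i), f (Fin.snoc (m i) z) := by
  classical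
  rw [Finset.sum_sigma']
  symm
  refine Finset.sum_bij (fun a _ => (Fin.snoc (m a.1) a.2 : Fin (l + 1) → ℝ)) ?_ ?_ ?_ ?_
  · rintro ⟨i, z⟩ h
    simpa [mem_childFinset] using h
  · rintro ⟨i, z⟩ _ ⟨i', z'⟩ _ h
    obtain ⟨h1, h2⟩ := Fin.snoc_inj.1 h
    obtain rfl := hm h1
    simp only at h2
    rw [h2]
  · intro x hx
    have : (Fin.init x : Fin l → ℝ) ∈ Set.range m := by
      rw [hr, mem_proj_succ]
      exact ⟨x, hx, rfl⟩
    obtain ⟨i, hi⟩ := this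
    refine ⟨⟨i, x (Fin.last l)⟩, ?_, ?_⟩
    · simp only [Finset.mem_sigma, Finset.mem_univ, true_and, mem_childFinset, hi,
        Fin.snoc_init_self]
      exact hx
    · simp [hi]
  · intros
    rfl

theorem block_subset {n : ℕ} {c : Fin n → ℕ} {i : Fin n} {t : ℕ} (h : t ∈ block c i) : t < c i :=
  h.1

/-- The least index whose cardinality exceeds `t` works; monotonicity is not needed. -/
theorem exists_mem_block {n : ℕ} (c : Fin n → ℕ) {i : Fin n} {t : ℕ} (h : t < c i) :
    ∃ i' ≤ i, t ∈ block c i' := by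
  classical
  let s := Finset.univ.filter fun i' : Fin n => t < c i'
  have hs : s.Nonempty := ⟨i, by simp [s, h]⟩
  refine ⟨s.min' hs, s.min'_le _ (by simp [s, h]), ?_, ?_⟩
  · have := s.min'_mem hs
    simpa [s] using this
  · intro i' hi'
    by_contra hlt
    have := s.min'_le i' (by simpa [s] using hlt)
    have := Fin.le_def.1 this
    omega

theorem block_disjoint {n : ℕ} {c : Fin n → ℕ} (hc : Monotone c) {i i' : Fin n} {t : ℕ}
    (h : t ∈ block c i) (h' : t ∈ block c i') : i = i' := by
  have key : ∀ a b : Fin n, t ∈ block c a → t ∈ block c b → ¬ a < b := by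
    intro a b ha hb hab
    have hab' := Fin.lt_def.1 hab
    have h1 := hb.2 ⟨(b : ℕ) - 1, by omega⟩ (by simp only; omega)
    have h2 : c a ≤ c ⟨(b : ℕ) - 1, by omega⟩ := hc (Fin.le_def.2 (by simp only; omega))
    have := ha.1
    omega
  rcases lt_trichotomy i i' with hlt | rfl | hlt
  · exact (key _ _ h h' hlt).elim
  · rfl
  · exact (key _ _ h' h hlt).elim

/-! ### Nonsingularity of the generalized Vandermonde system -/

theorem eq_zero_of_forall_sum_mul_pow_eq_zero {F : Type*} [Field F] {ι : Type*} (Z : Finset ι)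
    (W a : ι → F) (hW : Set.InjOn W Z) (h : ∀ t < Z.card, ∑ z ∈ Z, a z * W z ^ t = 0) :
    ∀ z ∈ Z, a z = 0 := by
  classical
  let e := Z.equivFin
  have hf : Function.Injective fun i => W (e.symm i) := fun i i' hii => by
    have := hW (e.symm i).2 (e.symm i').2 hii
    exact e.symm.injective (Subtype.ext this)
  have := Matrix.eq_zero_of_forall_pow_sum_mul_pow_eq_zero (v := fun i => a (e.symm i)) hf
    (fun t => by
      have h1 := h t t.2
      rw [← Finset.sum_coe_sort] at h1
      rw [← h1]
      exact Equiv.sum_comp e.symm (fun z : Z => a z * W z ^ (t : ℕ)))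
  intro z hz
  have h2 := congrFun this (e ⟨z, hz⟩)
  simpa using h2

/-- The monomials indexed by a shift index set of `M` separate the functions on `M`, if the values
of each variable on siblings are distinct. -/
theorem eq_zero_of_isShiftIndexSet {F : Type*} [Field F] : ∀ {d : ℕ} (M : Finset (Fin d → ℝ))
    {K : Set (Fin d → ℕ)}, IsShiftIndexSet d (M : Set (Fin d → ℝ)) K →
    ∀ (w : Fin d → ℝ → F), (∀ i, ∀ m ∈ M, ∀ m' ∈ M, (∀ i' < i, m i' = m' i') →
      w i (m i) = w i (m' i) → m i = m' i) →
    ∀ c : (Fin d → ℝ) → F, (∀ j ∈ K, ∑ m ∈ M, c m * ∏ i, w i (m i) ^ j i = 0) →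
    ∀ m ∈ M, c m = 0
  | 0, M, K, hK, w, hw, c, h, m, hm => by
    have hK : K = {_j | (M : Set (Fin 0 → ℝ)).Nonempty} := hK
    have h0 := h 0 (by rw [hK]; exact ⟨m, hm⟩)
    have hM : M = {m} := by
      ext x
      simp [Subsingleton.elim x m, hm]
    simpa [hM] using h0
  | l + 1, M, K, hK, w, hw, c, h, x, hx => by
    classical
    obtain ⟨n, m, K', hinj, hr, hmono, hK', rfl⟩ := hK
    simp only [ncard_children] at hmono h
    have hproj : ∀ i, ∃ y ∈ M, (Fin.init y : Fin l → ℝ) = m i := fun i => by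
      have : m i ∈ Set.range m := ⟨i, rfl⟩
      rw [hr, mem_proj_succ] at this
      exact this
    have key : ∀ i, ∀ z ∈ childFinset M (m i), c (Fin.snoc (m i) z) = 0 := by
      intro i
      -- Strong induction along the enumeration: the coefficients over all earlier parents are
      -- already zero.
      induction i using WellFoundedLT.induction with
      | ind i ih =>
      refine eq_zero_of_forall_sum_mul_pow_eq_zero (childFinset M (m i)) (w (Fin.last l))
        (fun z => c (Fin.snoc (m i) z)) ?_ ?_
      · intro z hz z' hz' hzz
        have := hw (Fin.last l) _ (mem_childFinset.1 hz) _ (mem_childFinset.1 hz')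
          (fun i' hi' => by
            obtain ⟨i', rfl⟩ := Fin.exists_castSucc_eq.2 hi'.ne
            simp) (by simpa using hzz)
        simpa using this
      · intro t ht
        obtain ⟨i₀, hi₀, htb⟩ := exists_mem_block (fun i => (childFinset M (m i)).card) ht
        -- The `t`-th moments over the parents; they are the coefficients of the system in one
        -- dimension less.
        let S : (Fin l → ℝ) → F := fun p =>
          ∑ z ∈ childFinset M p, c (Fin.snoc p z) * w (Fin.last l) z ^ t
        have hfin : ((((Finset.Ici i₀).image m : Finset (Fin l → ℝ))) : Set (Fin l → ℝ))
            = m '' Set.Ici i₀ := by simp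
        refine eq_zero_of_isShiftIndexSet ((Finset.Ici i₀).image m) (hfin ▸ hK' i₀)
          (fun i' => w i'.castSucc) ?_ S ?_ (m i) (Finset.mem_image_of_mem _ (by simpa using hi₀))
        · intro a p hp p' hp' hlt heq
          obtain ⟨b, -, rfl⟩ := Finset.mem_image.1 hp
          obtain ⟨b', -, rfl⟩ := Finset.mem_image.1 hp'
          obtain ⟨y, hy, hyb⟩ := hproj b
          obtain ⟨y', hy', hyb'⟩ := hproj b'
          rw [← hyb, ← hyb'] at hlt heq ⊢
          refine hw a.castSucc y hy y' hy' (fun i' hi' => ?_) heq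
          obtain ⟨i', rfl⟩ := Fin.exists_castSucc_eq.2
            (hi'.trans (Fin.castSucc_lt_last a)).ne
          exact hlt i' (by simpa using hi')
        · intro j hj
          have h1 := h (Fin.snoc j t) (Set.mem_iUnion.2 ⟨i₀, by
            simpa using ⟨hj, htb⟩⟩)
          rw [sum_eq_sum_childFinset M hinj hr] at h1
          rw [Finset.sum_image (fun a _ b _ hab => hinj hab), ← h1]
          -- Passing from the parents after `i₀` to all parents costs nothing: those before `i₀ ≤ i`
          -- contribute zero by `ih`.
          refine Eq.trans (Finset.sum_congr rfl fun a _ => ?_)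
            (Finset.sum_subset (Finset.subset_univ (Finset.Ici i₀)) fun a _ ha => ?_)
          · simp only [S, Finset.sum_mul, Fin.prod_univ_castSucc, Fin.snoc_castSucc, Fin.snoc_last]
            refine Finset.sum_congr rfl fun z _ => ?_
            ring
          · refine Finset.sum_eq_zero fun z hz => ?_
            rw [ih a (lt_of_lt_of_le (by simpa using ha) hi₀) z hz, zero_mul]
    have hxr : (Fin.init x : Fin l → ℝ) ∈ Set.range m := by
      rw [hr, mem_proj_succ]
      exact ⟨x, hx, rfl⟩
    obtain ⟨i, hi⟩ := hxr
    have := key i (x (Fin.last l)) (by rw [mem_childFinset, hi, Fin.snoc_init_self]; exact hx)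
    rwa [hi, Fin.snoc_init_self] at this

/-! ### Existence and cardinality of shift index sets -/

theorem exists_isShiftIndexSet : ∀ {d : ℕ} (M : Finset (Fin d → ℝ)),
    ∃ K, IsShiftIndexSet d (M : Set (Fin d → ℝ)) K
  | 0, M => ⟨_, rfl⟩
  | l + 1, M => by
    classical
    let N : Finset (Fin l → ℝ) := M.image Fin.init
    let g : Fin N.card → Fin l → ℝ := fun i => N.equivFin.symm i
    have hg : Function.Injective g := Subtype.val_injective.comp N.equivFin.symm.injective
    let σ := Tuple.sort fun i => (children (M : Set (Fin (l + 1) → ℝ)) (g i)).ncard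
    have hσ := Tuple.monotone_sort fun i => (children (M : Set (Fin (l + 1) → ℝ)) (g i)).ncard
    have hex : ∀ i, ∃ K', IsShiftIndexSet l ((g ∘ σ) '' Set.Ici i) K' := fun i => by
      obtain ⟨K', hK'⟩ := exists_isShiftIndexSet ((Finset.Ici i).image (g ∘ σ))
      exact ⟨K', by simpa using hK'⟩
    choose K' hK' using hex
    refine ⟨_, N.card, g ∘ σ, K', hg.comp σ.injective, ?_, hσ, hK', rfl⟩
    ext p
    rw [mem_proj_succ]
    simp only [Set.mem_range, g, Function.comp_apply]
    constructor
    · rintro ⟨i, rfl⟩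
      exact Finset.mem_image.1 (N.equivFin.symm (σ i)).2
    · rintro ⟨m, hm, rfl⟩
      exact ⟨σ.symm (N.equivFin ⟨_, Finset.mem_image_of_mem _ hm⟩), by simp⟩

/-- The `i`-th product has `#{m_i, …, m_n} · #Q_i` elements, and the blocks up to `Q_i` partition
`{0, …, c i - 1}`. Double counting of the pairs `i' ≤ i` turns the total into the number of all
children. -/
theorem encard_isShiftIndexSet : ∀ {d : ℕ} (M : Finset (Fin d → ℝ)) {K : Set (Fin d → ℕ)},
    IsShiftIndexSet d (M : Set (Fin d → ℝ)) K → K.encard = M.card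
  | 0, M, K, hK => by
    have hK : K = {_j | (M : Set (Fin 0 → ℝ)).Nonempty} := hK
    rcases M.eq_empty_or_nonempty with rfl | hM
    · simp [hK]
    · obtain ⟨m, hm⟩ := hM
      have hM : M = {m} := by
        ext x
        simp [Subsingleton.elim x m, hm]
      have : K = {0} := by
        ext x
        simp [hK, hM, Subsingleton.elim x 0]
      simp [this, hM]
  | l + 1, M, K, hK => by
    classical
    obtain ⟨n, m, K', hinj, hr, hmono, hK', rfl⟩ := hK
    simp only [ncard_children] at hmono ⊢
    have hcard : ∀ i, (K' i).encard = ((Finset.Ici i).card : ℕ) := fun i => by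
      rw [encard_isShiftIndexSet ((Finset.Ici i).image m) (by simpa using hK' i),
        Finset.card_image_of_injective _ hinj]
    have hfin : ∀ i, (K' i).Finite := fun i => by
      rw [← Set.encard_lt_top_iff, hcard]
      exact ENat.natCast_lt_top _
    let c : Fin n → ℕ := fun i => (childFinset M (m i)).card
    let b : Fin n → Finset ℕ := fun i => (Finset.range (c i)).filter (· ∈ block c i)
    have hb : ∀ i t, t ∈ b i ↔ t ∈ block c i := fun i t => by
      simpa [b] using fun h => block_subset h
    let E : Fin n → Finset (Fin (l + 1) → ℕ) := fun i =>
      ((hfin i).toFinset ×ˢ b i).image fun a => Fin.snoc a.1 a.2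
    have hE : ∀ i j, j ∈ E i ↔ (Fin.init j : Fin l → ℕ) ∈ K' i ∧ j (Fin.last l) ∈ block c i := by
      intro i j
      simp only [E, Finset.mem_image, Finset.mem_product, Set.Finite.mem_toFinset, hb]
      constructor
      · rintro ⟨⟨p, t⟩, h, rfl⟩
        simpa using h
      · intro h
        exact ⟨(Fin.init j, j (Fin.last l)), h, Fin.snoc_init_self j⟩
    have hEcard : ∀ i, (E i).card = (Finset.Ici i).card * (b i).card := fun i => by
      rw [Finset.card_image_of_injective _ (fun a a' h => by
        obtain ⟨h1, h2⟩ := Fin.snoc_inj.1 h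
        exact Prod.ext h1 h2), Finset.card_product]
      congr 1
      have := hcard i
      rw [(hfin i).encard_eq_coe_toFinset_card] at this
      exact_mod_cast this
    have hset : (⋃ i, {j : Fin (l + 1) → ℕ | (Fin.init j : Fin l → ℕ) ∈ K' i ∧
        j (Fin.last l) ∈ block c i}) = (Finset.univ.biUnion E : Finset (Fin (l + 1) → ℕ)) := by
      ext j
      simp [hE]
    have hcb : ∀ i, ∑ i' ∈ Finset.Iic i, (b i').card = c i := fun i => by
      rw [← Finset.card_biUnion]
      · conv_rhs => rw [← Finset.card_range (c i)]
        congr 1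
        ext t
        simp only [Finset.mem_biUnion, Finset.mem_Iic, hb, Finset.mem_range]
        constructor
        · rintro ⟨i', hi', ht⟩
          exact (block_subset ht).trans_le (hmono hi')
        · intro ht
          exact exists_mem_block c ht
      · intro i₁ _ i₂ _ hne
        rw [Function.onFun, Finset.disjoint_left]
        intro t h1 h2
        exact hne (block_disjoint hmono ((hb _ _).1 h1) ((hb _ _).1 h2))
    change (⋃ i, {j : Fin (l + 1) → ℕ | (Fin.init j : Fin l → ℕ) ∈ K' i ∧
        j (Fin.last l) ∈ block c i}).encard = _
    rw [hset, Set.encard_coe_eq_coe_finsetCard, Finset.card_biUnion]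
    · norm_cast
      simp only [hEcard, Finset.card_eq_sum_ones M, sum_eq_sum_childFinset M hinj hr]
      simp only [← Finset.card_eq_sum_ones]
      change _ = ∑ i, c i
      simp only [← hcb, ← smul_eq_mul, ← Finset.sum_const]
      exact Finset.sum_comm' (by simp)
    · intro i₁ _ i₂ _ hne
      rw [Function.onFun, Finset.disjoint_left]
      intro j h1 h2
      exact hne (block_disjoint hmono ((hE _ _).1 h1).2 ((hE _ _).1 h2).2)

/-! ### Uniqueness of Fourier coefficients on the torus -/

/-- Integration against `G` is continuous in the sup norm, and trigonometric polynomials are dense.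
As `μ` is arbitrary, pushforward measures need not be compared with Haar measure. -/
theorem integral_mul_eq_zero_of_forall_mFourier {d : ℕ} {μ : Measure (UnitAddTorus (Fin d))}
    {G : UnitAddTorus (Fin d) → ℂ} (hG : Integrable G μ)
    (h : ∀ z : Fin d → ℤ, ∫ x, G x * UnitAddTorus.mFourier z x ∂μ = 0)
    (g : C(UnitAddTorus (Fin d), ℂ)) : ∫ x, G x * g x ∂μ = 0 := by
  have hint : ∀ g : C(UnitAddTorus (Fin d), ℂ), Integrable (fun x => G x * g x) μ := fun g =>
    hG.mul_bdd (c := ‖g‖) g.continuous.aestronglyMeasurable (ae_of_all _ g.norm_coe_le_norm)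
  let T : C(UnitAddTorus (Fin d), ℂ) →ₗ[ℂ] ℂ :=
    { toFun := fun g => ∫ x, G x * g x ∂μ
      map_add' := fun g g' => by
        rw [← integral_add (hint g) (hint g')]
        simp only [ContinuousMap.add_apply, mul_add]
      map_smul' := fun a g => by
        rw [RingHom.id_apply, smul_eq_mul, ← integral_const_mul]
        simp only [ContinuousMap.smul_apply, smul_eq_mul, mul_left_comm] }
  have hT : ∀ g, ‖T g‖ ≤ (∫ x, ‖G x‖ ∂μ) * ‖g‖ := fun g => by
    rw [← integral_mul_const]
    refine norm_integral_le_of_norm_le (hG.norm.mul_const _) (ae_of_all _ fun x => ?_)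
    rw [norm_mul]
    exact mul_le_mul_of_nonneg_left (g.norm_coe_le_norm x) (norm_nonneg _)
  let T' := T.mkContinuous _ hT
  have hcl : IsClosed (LinearMap.ker T : Set C(UnitAddTorus (Fin d), ℂ)) :=
    T'.isClosed_ker
  have hspan : Submodule.span ℂ (Set.range (UnitAddTorus.mFourier (d := Fin d)))
      ≤ LinearMap.ker T := by
    rw [Submodule.span_le]
    rintro _ ⟨z, rfl⟩
    exact h z
  have := Submodule.topologicalClosure_minimal _ hspan hcl
  rw [UnitAddTorus.span_mFourier_closure_eq_top] at this
  exact this (Submodule.mem_top : g ∈ _)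

/-- An integrable function on the torus is determined by its Fourier coefficients. -/
theorem ae_eq_zero_of_forall_mFourier {d : ℕ} {μ : Measure (UnitAddTorus (Fin d))}
    {G : UnitAddTorus (Fin d) → ℂ} (hG : Integrable G μ)
    (h : ∀ z : Fin d → ℤ, ∫ x, G x * UnitAddTorus.mFourier z x ∂μ = 0) : G =ᵐ[μ] 0 := by
  refine ae_eq_zero_of_forall_setIntegral_isClosed_eq_zero hG fun s hs => ?_
  -- Continuous functions bounded by 1 that converge pointwise to the indicator of `s`.
  let u : ℕ → UnitAddTorus (Fin d) → ℝ := fun n x => (hs.apprSeq n x : ℝ)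
  have hu : ∀ n, Continuous (u n) := fun n =>
    NNReal.continuous_coe.comp (hs.apprSeq n).continuous
  have hz : ∀ n, ∫ x, G x * (u n x : ℂ) ∂μ = 0 := fun n =>
    integral_mul_eq_zero_of_forall_mFourier hG h
      ⟨fun x => (u n x : ℂ), Complex.continuous_ofReal.comp (hu n)⟩
  have hlim : Tendsto (fun n => ∫ x, G x * (u n x : ℂ) ∂μ) atTop
      (𝓝 (∫ x, G x * (s.indicator (fun _ => (1 : ℂ)) x) ∂μ)) := by
    refine tendsto_integral_of_dominated_convergence (fun x => ‖G x‖)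
      (fun n => hG.aestronglyMeasurable.mul
        (Complex.continuous_ofReal.comp (hu n)).aestronglyMeasurable) hG.norm
      (fun n => ae_of_all _ fun x => ?_) (ae_of_all _ fun x => ?_)
    · rw [norm_mul, Complex.norm_real, Real.norm_of_nonneg (NNReal.coe_nonneg _)]
      exact mul_le_of_le_one_right (norm_nonneg _)
        (by exact_mod_cast HasOuterApproxClosed.apprSeq_apply_le_one hs n x)
    · refine tendsto_const_nhds.mul ?_
      have h1 := (tendsto_pi_nhds.1 (HasOuterApproxClosed.tendsto_apprSeq hs)) x
      have h2 := (Complex.continuous_ofReal.comp NNReal.continuous_coe).continuousAt.tendsto.comp h1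
      have h3 : (Complex.ofReal ∘ NNReal.toReal) (s.indicator (fun _ => 1) x)
          = s.indicator (fun _ => (1 : ℂ)) x := by
        by_cases hx : x ∈ s <;> simp [hx]
      rwa [h3] at h2
  simp only [hz] at hlim
  have h0 := tendsto_nhds_unique hlim tendsto_const_nhds
  rw [← integral_indicator hs.measurableSet, ← h0]
  congr 1
  ext x
  by_cases hx : x ∈ s <;> simp [hx]

/-! ### Periodization along the integer lattice -/

/-- The half-open unit cube with lower corner `z`. -/
def cube {d : ℕ} (z : Fin d → ℤ) : Set (Fin d → ℝ) := {x | ∀ i, x i ∈ Set.Ioc (z i : ℝ) (z i + 1)}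

theorem measurableSet_cube {d : ℕ} (z : Fin d → ℤ) : MeasurableSet (cube z) :=
  MeasurableSet.univ_pi' fun _ => measurableSet_Ioc

theorem mem_cube_iff {d : ℕ} {z : Fin d → ℤ} {x : Fin d → ℝ} :
    x ∈ cube z ↔ ∀ i, ⌈x i⌉ - 1 = z i := by
  refine forall_congr' fun i => ?_
  rw [sub_eq_iff_eq_add, Int.ceil_eq_iff, Set.mem_Ioc]
  push_cast
  simp

theorem pairwise_disjoint_cube (d : ℕ) : Pairwise (Function.onFun Disjoint (cube (d := d))) := by
  intro z z' hne
  rw [Function.onFun, Set.disjoint_left]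
  intro x hx hx'
  rw [mem_cube_iff] at hx hx'
  exact hne (funext fun i => (hx i).symm.trans (hx' i))

theorem iUnion_cube (d : ℕ) : ⋃ z : Fin d → ℤ, cube z = Set.univ :=
  Set.eq_univ_of_forall fun x => Set.mem_iUnion.2 ⟨fun i => ⌈x i⌉ - 1, mem_cube_iff.2 fun _ => rfl⟩

theorem preimage_add_cube {d : ℕ} (z : Fin d → ℤ) :
    (fun x : Fin d → ℝ => x + fun i => (z i : ℝ)) ⁻¹' cube z = cube 0 := by
  ext x
  simp only [cube, Set.mem_preimage, Set.mem_ofPred_eq, Pi.add_apply, Set.mem_Ioc, Pi.zero_apply,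
    Int.cast_zero]
  refine forall_congr' fun i => ?_
  constructor <;> rintro ⟨h1, h2⟩ <;> constructor <;> linarith

theorem measurableEmbedding_add {d : ℕ} (a : Fin d → ℝ) :
    MeasurableEmbedding fun x : Fin d → ℝ => x + a :=
  (MeasurableEquiv.addRight a).measurableEmbedding

theorem lintegral_eq_tsum_cube {d : ℕ} (f : (Fin d → ℝ) → ℝ≥0∞) :
    ∫⁻ x, f x = ∑' z : Fin d → ℤ, ∫⁻ x in cube 0, f (x + fun i => (z i : ℝ)) := by
  rw [← setLIntegral_univ, ← iUnion_cube,
    lintegral_iUnion measurableSet_cube (pairwise_disjoint_cube d)]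
  refine tsum_congr fun z => ?_
  rw [← preimage_add_cube z, (measurePreserving_add_right volume _).setLIntegral_comp_preimage_emb
    (measurableEmbedding_add _)]

theorem integral_eq_tsum_cube {d : ℕ} {f : (Fin d → ℝ) → ℂ} (hf : Integrable f) :
    ∫ x, f x = ∑' z : Fin d → ℤ, ∫ x in cube 0, f (x + fun i => (z i : ℝ)) := by
  rw [← setIntegral_univ, ← iUnion_cube,
    integral_iUnion measurableSet_cube (pairwise_disjoint_cube d) hf.integrableOn]
  refine tsum_congr fun z => ?_
  rw [← preimage_add_cube z, (measurePreserving_add_right volume _).setIntegral_preimage_emb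
    (measurableEmbedding_add _)]

/-- The covering map of the torus. -/
def toTorus {d : ℕ} (x : Fin d → ℝ) : UnitAddTorus (Fin d) := fun i => (x i : UnitAddCircle)

theorem measurable_toTorus {d : ℕ} : Measurable (toTorus (d := d)) :=
  measurable_pi_lambda _ fun i => AddCircle.measurable_mk'.comp (measurable_pi_apply i)

theorem toTorus_add_intCast {d : ℕ} (x : Fin d → ℝ) (z : Fin d → ℤ) :
    toTorus (x + fun i => (z i : ℝ)) = toTorus x := by
  ext i
  simp only [toTorus, Pi.add_apply, AddCircle.coe_add]
  have : ((z i : ℝ) : UnitAddCircle) = 0 := by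
    rw [AddCircle.coe_eq_zero_iff]
    exact ⟨z i, by simp⟩
  rw [this, add_zero]

/-- The section of the covering map with values in the unit cube. -/
noncomputable def ofTorus {d : ℕ} (τ : UnitAddTorus (Fin d)) : Fin d → ℝ :=
  (UnitAddTorus.measurableEquivPiIoc (fun _ => (0 : ℝ)) τ).1

theorem measurable_ofTorus {d : ℕ} : Measurable (ofTorus (d := d)) :=
  measurable_subtype_coe.comp (MeasurableEquiv.measurable _)

theorem ofTorus_toTorus {d : ℕ} {x : Fin d → ℝ} (hx : x ∈ cube 0) : ofTorus (toTorus x) = x := by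
  have hx' : ∀ i, x i ∈ Set.Ioc (0 : ℝ) (0 + 1) := by simpa [cube] using hx
  exact congrArg Subtype.val
    ((UnitAddTorus.measurableEquivPiIoc (fun _ => (0 : ℝ))).apply_symm_apply ⟨x, hx'⟩)

theorem ae_cube_eq_zero {d : ℕ} {F : (Fin d → ℝ) → ℂ} (hF : IntegrableOn F (cube 0))
    (h : ∀ z : Fin d → ℤ, ∫ x in cube 0, F x * UnitAddTorus.mFourier z (toTorus x) = 0) :
    ∀ᵐ x ∂(volume.restrict (cube (0 : Fin d → ℤ))), F x = 0 := by
  set ν := volume.restrict (cube (0 : Fin d → ℤ))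
  have hν : ∀ᵐ x ∂ν, ofTorus (toTorus x) = x :=
    (ae_restrict_mem (measurableSet_cube 0)).mono fun x hx => ofTorus_toTorus hx
  have hmp : MeasurePreserving (ofTorus (d := d)) (ν.map toTorus) ν := by
    refine ⟨measurable_ofTorus, ?_⟩
    rw [Measure.map_map measurable_ofTorus measurable_toTorus]
    exact (Measure.map_congr hν).trans Measure.map_id
  have hint : Integrable (F ∘ ofTorus) (ν.map toTorus) := hmp.integrable_comp_of_integrable hF
  have h0 := ae_eq_zero_of_forall_mFourier hint fun z => by
    refine (integral_map measurable_toTorus.aemeasurable (hint.aestronglyMeasurable.mul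
      (UnitAddTorus.mFourier z).continuous.aestronglyMeasurable)).trans ?_
    rw [← h z]
    refine integral_congr_ae (hν.mono fun x hx => ?_)
    simp only [Pi.mul_apply, Function.comp_apply, hx]
  filter_upwards [hν, ae_of_ae_map measurable_toTorus.aemeasurable h0] with x hx h1
  simpa [hx] using h1

/-- If the Fourier transform of an integrable function vanishes on the integer lattice, then so does
its periodization. -/
theorem ae_cube_tsum_eq_zero {d : ℕ} {f : (Fin d → ℝ) → ℂ} (hf : Integrable f)
    (h : ∀ z : Fin d → ℤ, ∫ x, f x * UnitAddTorus.mFourier z (toTorus x) = 0) :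
    ∀ᵐ x ∂(volume.restrict (cube (0 : Fin d → ℤ))),
      ∑' z : Fin d → ℤ, f (x + fun i => (z i : ℝ)) = 0 := by
  have hmeas : ∀ z : Fin d → ℤ, AEStronglyMeasurable (fun x => f (x + fun i => (z i : ℝ)))
      (volume.restrict (cube (0 : Fin d → ℤ))) := fun z =>
    (hf.aestronglyMeasurable.comp_measurePreserving
      (measurePreserving_add_right volume fun i => (z i : ℝ))).restrict
  -- Tonelli: the `L¹` norms over the cubes add up to that of `f`, so the periodization converges
  -- absolutely almost everywhere.
  have hfin : ∑' z : Fin d → ℤ, ∫⁻ x in cube 0, ‖f (x + fun i => (z i : ℝ))‖ₑ ≠ ∞ := by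
    rw [← lintegral_eq_tsum_cube fun x => ‖f x‖ₑ]
    exact hf.2.ne
  have hle : ∫⁻ x in cube 0, ∑' z : Fin d → ℤ, ‖f (x + fun i => (z i : ℝ))‖ₑ ≠ ∞ := by
    rwa [lintegral_tsum fun z => (hmeas z).enorm]
  have hsum : ∀ᵐ x ∂(volume.restrict (cube (0 : Fin d → ℤ))),
      Summable fun z : Fin d → ℤ => ‖f (x + fun i => (z i : ℝ))‖ := by
    filter_upwards [ae_lt_top' (AEMeasurable.tsum fun z => (hmeas z).enorm) hle] with x hx
    exact tsum_enorm_ne_top_iff_summable_norm.1 hx.ne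
  refine ae_cube_eq_zero ⟨?_, ?_⟩ fun z => ?_
  · refine aestronglyMeasurable_of_tendsto_ae atTop
      (f := fun (s : Finset (Fin d → ℤ)) x => ∑ z ∈ s, f (x + fun i => (z i : ℝ)))
      (fun s => Finset.aestronglyMeasurable_fun_sum s fun z _ => hmeas z) ?_
    filter_upwards [hsum] with x hx
    exact hx.of_norm.hasSum
  · refine lt_of_le_of_lt (lintegral_mono_ae ?_) hle.lt_top
    filter_upwards [hsum] with x hx
    exact enorm_tsum_le_tsum_enorm
  · have hbd : ∀ x, ‖UnitAddTorus.mFourier z (toTorus x)‖ ≤ 1 := fun x => by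
      simpa [UnitAddTorus.mFourier_norm] using
        (UnitAddTorus.mFourier z).norm_coe_le_norm (toTorus x)
    have hm : Measurable fun x => UnitAddTorus.mFourier z (toTorus (d := d) x) :=
      (UnitAddTorus.mFourier z).continuous.measurable.comp measurable_toTorus
    have h1 := integral_eq_tsum_cube (hf.mul_bdd (c := 1) hm.aestronglyMeasurable (ae_of_all _ hbd))
    rw [h z] at h1
    simp only [toTorus_add_intCast] at h1
    rw [h1, ← integral_tsum]
    · simp only [tsum_mul_right]
    · exact fun z' => (hmeas z').mul hm.aestronglyMeasurable
    · refine ne_top_of_le_ne_top hfin (ENNReal.tsum_le_tsum fun z' => lintegral_mono fun x => ?_)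
      rw [enorm_mul]
      refine mul_le_of_le_one_right' ?_
      rw [← ofReal_norm]
      exact ENNReal.ofReal_le_one.2 (hbd x)

/-! ### Periodization along a general lattice, and the tiling condition -/

theorem mem_lattice_mulVec {d : ℕ} (A : Matrix (Fin d) (Fin d) ℝ) (z : Fin d → ℤ) :
    A *ᵥ (fun i => (z i : ℝ)) ∈ lattice A := ⟨z, rfl⟩

theorem neg_mem_lattice {d : ℕ} {A : Matrix (Fin d) (Fin d) ℝ} {l : Fin d → ℝ}
    (h : l ∈ lattice A) : -l ∈ lattice A := by
  obtain ⟨z, rfl⟩ := h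
  refine ⟨-z, ?_⟩
  rw [← Matrix.mulVec_neg]
  congr 1
  ext i
  simp

/-- The lattice is countable, so the translates of the exceptional null set still form a null set.
-/
theorem ae_of_sub_mem_lattice {d : ℕ} {A : Matrix (Fin d) (Fin d) ℝ} {S : Set (Fin d → ℝ)}
    (hS : MeasurableSet S) {P : (Fin d → ℝ) → Prop} (h : ∀ᵐ x ∂(volume.restrict S), P x) :
    ∀ᵐ y, ∀ x ∈ S, y - x ∈ lattice A → P x := by
  rw [ae_restrict_iff' hS] at h
  have h' : ∀ᵐ y : Fin d → ℝ, ∀ z : Fin d → ℤ, y - A *ᵥ (fun i => (z i : ℝ)) ∈ S →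
      P (y - A *ᵥ (fun i => (z i : ℝ))) := by
    rw [ae_all_iff]
    intro z
    exact (measurePreserving_sub_right volume _).quasiMeasurePreserving.ae h
  filter_upwards [h'] with y hy x hx hyx
  obtain ⟨z, hz⟩ := hyx
  have hxz : y - A *ᵥ (fun i => (z i : ℝ)) = x := by rw [← hz]; abel
  have := hy z
  rw [hxz] at this
  exact this hx

theorem ae_tsum_int_eq_zero {d : ℕ} {f : (Fin d → ℝ) → ℂ} (hf : Integrable f)
    (h : ∀ z : Fin d → ℤ, ∫ x, f x * UnitAddTorus.mFourier z (toTorus x) = 0) :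
    ∀ᵐ x : Fin d → ℝ, ∑' z : Fin d → ℤ, f (x + fun i => (z i : ℝ)) = 0 := by
  filter_upwards [ae_of_sub_mem_lattice (A := 1) (measurableSet_cube 0)
    (ae_cube_tsum_eq_zero hf h)] with y hy
  let z₀ : Fin d → ℤ := fun i => ⌈y i⌉ - 1
  have h1 := hy (y - fun i => (z₀ i : ℝ)) (by
      rw [mem_cube_iff]
      intro i
      change ⌈y i - ((⌈y i⌉ - 1 : ℤ) : ℝ)⌉ - 1 = 0
      rw [Int.ceil_sub_intCast]
      ring) ⟨z₀, by simp⟩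
  rw [← h1, ← (Equiv.subRight z₀).tsum_eq]
  refine tsum_congr fun z => congrArg f ?_
  ext i
  simp only [Equiv.subRight_apply, Pi.add_apply, Pi.sub_apply, Int.cast_sub]
  ring

theorem expFun_add_left {d : ℕ} (a b x : Fin d → ℝ) :
    expFun (a + b) x = expFun a x * expFun b x := by
  simp only [expFun, add_dotProduct, Complex.ofReal_add, mul_add, Complex.exp_add]

theorem expFun_add_right {d : ℕ} (a x y : Fin d → ℝ) :
    expFun a (x + y) = expFun a x * expFun a y := by
  simp only [expFun, dotProduct_add, Complex.ofReal_add, mul_add, Complex.exp_add]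

theorem norm_expFun {d : ℕ} (a x : Fin d → ℝ) : ‖expFun a x‖ = 1 := by
  rw [expFun, show 2 * (Real.pi : ℂ) * Complex.I * ((a ⬝ᵥ x : ℝ) : ℂ)
    = ((2 * Real.pi * (a ⬝ᵥ x) : ℝ) : ℂ) * Complex.I by push_cast; ring]
  exact Complex.norm_exp_ofReal_mul_I _

theorem conj_expFun_ne_zero {d : ℕ} (a x : Fin d → ℝ) : conj (expFun a x) ≠ 0 := by
  rw [← norm_ne_zero_iff, RCLike.norm_conj, norm_expFun]
  exact one_ne_zero

theorem continuous_expFun {d : ℕ} (a : Fin d → ℝ) : Continuous (expFun a) := by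
  unfold expFun
  refine Complex.continuous_exp.comp (continuous_const.mul (Complex.continuous_ofReal.comp ?_))
  exact continuous_const.dotProduct continuous_id

theorem integrable_mul_conj_expFun {d : ℕ} {μ : Measure (Fin d → ℝ)} {f : (Fin d → ℝ) → ℂ}
    (hf : Integrable f μ) (a : Fin d → ℝ) : Integrable (fun x => f x * conj (expFun a x)) μ :=
  hf.mul_bdd (c := 1) (Complex.continuous_conj.comp (continuous_expFun a)).aestronglyMeasurable
    (ae_of_all _ fun x => by simp [norm_expFun])

/-- The sign of `z` flips because the data pair with conjugate exponentials. -/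
theorem mFourier_toTorus {d : ℕ} {A : Matrix (Fin d) (Fin d) ℝ} (hA : A.det ≠ 0)
    (z : Fin d → ℤ) (t : Fin d → ℝ) :
    UnitAddTorus.mFourier z (toTorus t)
      = conj (expFun ((A⁻¹)ᵀ *ᵥ (fun i => ((-z) i : ℝ))) (A *ᵥ t)) := by
  have h1 : (A⁻¹)ᵀ *ᵥ (fun i => (((-z) i : ℤ) : ℝ)) ⬝ᵥ (A *ᵥ t) = -∑ i, (z i : ℝ) * t i := by
    rw [Matrix.mulVec_transpose, ← Matrix.dotProduct_mulVec, Matrix.mulVec_mulVec,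
      Matrix.nonsing_inv_mul _ (isUnit_iff_ne_zero.2 hA), Matrix.one_mulVec]
    simp [dotProduct]
  rw [expFun, h1, ← Complex.exp_conj]
  simp only [UnitAddTorus.mFourier, ContinuousMap.coe_mk, toTorus, fourier_coe_apply]
  rw [← Complex.exp_sum]
  congr 1
  simp only [map_mul, Complex.conj_ofReal, Complex.conj_I, map_ofNat]
  push_cast
  simp only [mul_neg, neg_mul, neg_neg, Finset.mul_sum, ← Finset.sum_neg_distrib]
  exact Finset.sum_congr rfl fun i _ => by ring

theorem map_mulVec_volume {d : ℕ} {A : Matrix (Fin d) (Fin d) ℝ} (hA : A.det ≠ 0) :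
    Measure.map (fun t => A *ᵥ t) volume
      = ENNReal.ofReal |A.det⁻¹| • (volume : Measure (Fin d → ℝ)) :=
  Real.map_matrix_volume_pi_eq_smul_volume_pi hA

theorem measurable_mulVec {d : ℕ} (A : Matrix (Fin d) (Fin d) ℝ) :
    Measurable fun t : Fin d → ℝ => A *ᵥ t :=
  (continuous_const.matrix_mulVec continuous_id).measurable

theorem quasiMeasurePreserving_mulVec {d : ℕ} {A : Matrix (Fin d) (Fin d) ℝ} (hA : A.det ≠ 0) :
    Measure.QuasiMeasurePreserving (fun t : Fin d → ℝ => A *ᵥ t) volume volume := by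
  refine ⟨measurable_mulVec A, ?_⟩
  rw [map_mulVec_volume hA]
  exact Measure.smul_absolutelyContinuous

/-- If the Fourier transform of an integrable function vanishes on the dual lattice, then the
periodization of the function along the lattice vanishes. -/
theorem ae_tsum_lattice_eq_zero {d : ℕ} {A : Matrix (Fin d) (Fin d) ℝ} (hA : A.det ≠ 0)
    {f : (Fin d → ℝ) → ℂ} (hf : Integrable f)
    (h : ∀ u ∈ dualLattice A, ∫ x, f x * conj (expFun u x) = 0) :
    ∀ᵐ x : Fin d → ℝ, ∑' z : Fin d → ℤ, f (x + A *ᵥ fun i => (z i : ℝ)) = 0 := by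
  have hmap := map_mulVec_volume hA
  have hint : ∀ {g : (Fin d → ℝ) → ℂ}, Integrable g →
      Integrable g (Measure.map (fun t => A *ᵥ t) volume) := fun hg => by
    rw [hmap]
    exact hg.smul_measure ENNReal.ofReal_ne_top
  have h1 := ae_tsum_int_eq_zero (f := fun t => f (A *ᵥ t))
    ((hint hf).comp_measurable (measurable_mulVec A)) fun z => by
      simp only [mFourier_toTorus hA]
      set u := (A⁻¹)ᵀ *ᵥ (fun i => (((-z) i : ℤ) : ℝ))
      have h2 := integral_map (measurable_mulVec A).aemeasurable
        (hint (integrable_mul_conj_expFun hf u)).aestronglyMeasurable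
      rw [← h2, hmap, integral_smul_measure, h u ⟨-z, rfl⟩, smul_zero]
  have hA' : (A⁻¹).det ≠ 0 := by
    rw [Matrix.det_nonsing_inv, Ring.inverse_eq_inv']
    exact inv_ne_zero hA
  filter_upwards [(quasiMeasurePreserving_mulVec hA').ae h1] with x hx
  rw [← hx]
  refine tsum_congr fun z => congrArg f ?_
  rw [Matrix.mulVec_add, Matrix.mulVec_mulVec,
    Matrix.mul_nonsing_inv _ (isUnit_iff_ne_zero.2 hA), Matrix.one_mulVec]

theorem measurableSet_fundDomain {d : ℕ} {A : Matrix (Fin d) (Fin d) ℝ} (hA : A.det ≠ 0) :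
    MeasurableSet (fundDomain A) := by
  have : fundDomain A = (fun x => A⁻¹ *ᵥ x) ⁻¹' {t | ∀ i, t i ∈ Set.Ico (0 : ℝ) 1} := by
    ext x
    simp only [fundDomain, Set.mem_ofPred_eq, Set.mem_preimage]
    constructor
    · rintro ⟨t, ht, rfl⟩
      rwa [Matrix.mulVec_mulVec, Matrix.nonsing_inv_mul _ (isUnit_iff_ne_zero.2 hA),
        Matrix.one_mulVec]
    · intro h
      refine ⟨_, h, ?_⟩
      rw [Matrix.mulVec_mulVec, Matrix.mul_nonsing_inv _ (isUnit_iff_ne_zero.2 hA),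
        Matrix.one_mulVec]
  rw [this]
  exact measurable_mulVec _ (MeasurableSet.univ_pi' fun _ => measurableSet_Ico)

theorem IsMultiTile.ae_encard_freqSet {d k : ℕ} {A : Matrix (Fin d) (Fin d) ℝ}
    {Ω : Set (Fin d → ℝ)} (hΩ : IsMultiTile A Ω k) :
    ∀ᵐ x : Fin d → ℝ, (freqSet A Ω x).encard = k := by
  filter_upwards [hΩ.tile] with x hx
  let e : lattice A ≃ lattice A :=
    { toFun := fun l => ⟨-l, neg_mem_lattice l.2⟩
      invFun := fun l => ⟨-l, neg_mem_lattice l.2⟩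
      left_inv := fun l => by simp
      right_inv := fun l => by simp }
  rw [← e.tsum_eq] at hx
  have hx' : ∑' l : lattice A, Ω.indicator (fun _ => (1 : ℝ≥0∞)) (x + l) = k := by
    rw [← hx]
    refine tsum_congr fun l => ?_
    change _ = Ω.indicator (fun _ => (1 : ℝ≥0∞)) (x - -(l : Fin d → ℝ))
    rw [sub_neg_eq_add]
  rw [tsum_subtype (lattice A) fun l => Ω.indicator (fun _ => (1 : ℝ≥0∞)) (x + l)] at hx'
  have hcard : ((freqSet A Ω x).encard : ℝ≥0∞) = k := by
    rw [← ENNReal.tsum_set_one, tsum_subtype (freqSet A Ω x) fun _ => (1 : ℝ≥0∞), ← hx']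
    refine tsum_congr fun l => ?_
    by_cases hl : l ∈ lattice A <;> by_cases hl' : x + l ∈ Ω <;>
      simp [freqSet, Set.indicator, hl, hl']
  exact_mod_cast hcard

theorem sum_freqSet {d : ℕ} {A : Matrix (Fin d) (Fin d) ℝ} (hA : A.det ≠ 0) {Ω : Set (Fin d → ℝ)}
    {x : Fin d → ℝ} {M : Finset (Fin d → ℝ)} (hM : (M : Set (Fin d → ℝ)) = freqSet A Ω x)
    (g : (Fin d → ℝ) → ℂ) :
    ∑' z : Fin d → ℤ, Ω.indicator g (x + A *ᵥ fun i => (z i : ℝ)) = ∑ m ∈ M, g (x + m) := by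
  classical
  have hinj : Function.Injective fun z : Fin d → ℤ => A *ᵥ fun i => (z i : ℝ) := fun z z' h => by
    have := Matrix.mulVec_injective_of_isUnit
      ((Matrix.isUnit_iff_isUnit_det A).2 (isUnit_iff_ne_zero.2 hA)) h
    ext i
    exact_mod_cast congrFun this i
  have hmem : ∀ m, m ∈ M ↔ m ∈ lattice A ∧ x + m ∈ Ω := fun m => by
    rw [← Finset.mem_coe, hM]
    rfl
  have h1 : ∑ m ∈ M, g (x + m)
      = ∑' m, (freqSet A Ω x).indicator (fun m => g (x + m)) m := by
    rw [← hM, tsum_eq_sum (s := M) fun m hm => by simp [hm]]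
    exact Finset.sum_congr rfl fun m hm => by simp [hm]
  rw [h1, ← hinj.tsum_eq]
  · refine tsum_congr fun z => ?_
    by_cases hz : x + A *ᵥ (fun i => (z i : ℝ)) ∈ Ω
    · rw [Set.indicator_of_mem hz, Set.indicator_of_mem (show _ ∈ freqSet A Ω x from
        ⟨mem_lattice_mulVec A z, hz⟩)]
    · rw [Set.indicator_of_notMem hz, Set.indicator_of_notMem (fun h => hz h.2)]
  · intro m hm
    have : m ∈ freqSet A Ω x := Set.mem_of_indicator_ne_zero hm
    obtain ⟨⟨z, rfl⟩, -⟩ := this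
    exact ⟨z, rfl⟩

/-! ### The linear system at a point of the fundamental domain -/

/-- The value at `z` of the variable in the coordinate `i`. -/
noncomputable def coordExp {d : ℕ} (v : Fin d → ℝ) (q : Fin d → ℕ) (i : Fin d) (z : ℝ) : ℂ :=
  conj (Complex.exp (2 * (Real.pi : ℂ) * Complex.I * ((v i / q i * z : ℝ) : ℂ)))

theorem conj_expFun_diagonal {d : ℕ} (v : Fin d → ℝ) (q j : Fin d → ℕ) (m : Fin d → ℝ) :
    conj (expFun (Matrix.diagonal (fun l => v l / (q l : ℝ)) *ᵥ (fun l => (j l : ℝ))) m)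
      = ∏ i, coordExp v q i (m i) ^ j i := by
  simp only [coordExp, ← map_pow, ← map_prod, ← Complex.exp_nat_mul, ← Complex.exp_sum, expFun,
    dotProduct, Matrix.mulVec_diagonal]
  congr 2
  push_cast
  rw [Finset.mul_sum]
  exact Finset.sum_congr rfl fun i _ => by ring

/-- Equal exponentials mean that `v_i z / q_i` and `v_i z' / q_i` differ by an integer, so `v_i z`
and `v_i z'` agree modulo `q_i`. -/
theorem DistinctMod.eq_of_coordExp_eq {d : ℕ} {v : Fin d → ℝ} {q : Fin d → ℕ} (hq : ∀ l, 0 < q l)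
    {M : Set (Fin d → ℝ)} (hM : DistinctMod v q M) (i : Fin d) {m m' : Fin d → ℝ} (hm : m ∈ M)
    (hm' : m' ∈ M) (hlt : ∀ i' < i, m i' = m' i')
    (h : coordExp v q i (m i) = coordExp v q i (m' i)) : m i = m' i := by
  have hq0 : (q i : ℝ) ≠ 0 := by exact_mod_cast (hq i).ne'
  have hsnoc : ∀ y : Fin d → ℝ, (Fin.snoc (fun a : Fin i => y (Fin.castLE i.2.le a)) (y i) :
      Fin (i + 1) → ℝ) = fun a => y (Fin.castLE i.2 a) := fun y => by
    ext a
    refine Fin.lastCases ?_ (fun a => ?_) a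
    · simp only [Fin.snoc_last]
      rfl
    · simp only [Fin.snoc_castSucc]
      rfl
  refine hM i i.2 (fun a => m (Fin.castLE i.2.le a)) ⟨m, hm, rfl⟩
    (x₁ := m i) (x₂ := m' i) ⟨m, hm, (hsnoc m).symm⟩ ⟨m', hm', ?_⟩ ?_
  · change (fun a => m' (Fin.castLE i.2 a)) = _
    rw [← hsnoc m']
    congr 1
    ext a
    exact (hlt _ (Fin.lt_def.2 a.2)).symm
  · have h1 := (starRingEnd ℂ).injective h
    obtain ⟨n, hn⟩ := Complex.exp_eq_exp_iff_exists_int.1 h1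
    have h2 : (v i / q i * m i : ℝ) = v i / q i * m' i + n := by
      have h3 : (2 * (Real.pi : ℂ) * Complex.I) * ((v i / q i * m i : ℝ) : ℂ)
          = (2 * (Real.pi : ℂ) * Complex.I) * ((v i / q i * m' i + n : ℝ) : ℂ) := by
        rw [hn]
        push_cast
        ring
      exact_mod_cast mul_left_cancel₀ Complex.two_pi_I_ne_zero h3
    have h4 : v i * m i - v i * m' i = n * q i := by
      field_simp at h2
      linarith
    change ((v i * m i : ℝ) : AddCircle (q i : ℝ)) = ((v i * m' i : ℝ) : AddCircle (q i : ℝ))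
    rw [← sub_eq_zero, ← AddCircle.coe_sub, AddCircle.coe_eq_zero_iff]
    exact ⟨n, by rw [h4, zsmul_eq_mul]⟩

theorem ae_freqSet_eq_zero {d k : ℕ} {A : Matrix (Fin d) (Fin d) ℝ} (hA : A.det ≠ 0)
    {Ω : Set (Fin d → ℝ)} (hΩ : IsMultiTile A Ω k) {v : Fin d → ℝ} {q : Fin d → ℕ}
    (hq : ∀ l, 0 < q l) (hadm : WeaklyAdmissible A Ω v q) (η : Fin d → ℝ)
    {K : Set (Fin d → ℕ)} {φ : (Fin d → ℝ) → ℂ} (hφ : IntegrableOn φ Ω)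
    (h : ∀ l ∈ dataFrequencies A v q η K, datum Ω φ l = 0) :
    ∀ᵐ x ∂(volume.restrict (fundDomain A)), IsShiftIndexSet d (freqSet A Ω x) K →
      ∀ m ∈ freqSet A Ω x, φ (x + m) = 0 := by
  have hint : ∀ a, IntegrableOn (fun x => φ x * conj (expFun a x)) Ω := fun a =>
    integrable_mul_conj_expFun hφ a
  have hper : ∀ᵐ x : Fin d → ℝ, ∀ j : Fin d → ℕ, j ∈ K → ∑' z : Fin d → ℤ,
      Ω.indicator (fun x => φ x * conj (expFun (latticeShift v q η j) x))
        (x + A *ᵥ fun i => (z i : ℝ)) = 0 := by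
    rw [ae_all_iff]
    intro j
    by_cases hj : j ∈ K
    · refine (ae_tsum_lattice_eq_zero hA ((hint _).integrable_indicator₀ hΩ.nullMeasurable)
        fun u hu => ?_).mono fun x hx _ => hx
      have h1 := h (u + latticeShift v q η j) (Set.mem_iUnion₂.2 ⟨j, hj, u, hu, rfl⟩)
      rw [datum, ← integral_indicator₀ hΩ.nullMeasurable] at h1
      rw [← h1]
      congr 1
      ext x
      by_cases hx : x ∈ Ω
      · simp only [Set.indicator_of_mem hx, expFun_add_left, map_mul]
        ring
      · simp only [Set.indicator_of_notMem hx, zero_mul]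
    · exact ae_of_all _ fun x hx => (hj hx).elim
  filter_upwards [hadm, ae_restrict_of_ae hper, ae_restrict_of_ae hΩ.ae_encard_freqSet]
    with x hdist hx hcard hK m hm
  have hfin : (freqSet A Ω x).Finite := by
    rw [← Set.encard_lt_top_iff, hcard]
    exact ENat.natCast_lt_top _
  have hM : (hfin.toFinset : Set (Fin d → ℝ)) = freqSet A Ω x := hfin.coe_toFinset
  have hmem : ∀ m, m ∈ hfin.toFinset ↔ m ∈ freqSet A Ω x := fun m => hfin.mem_toFinset
  have key := eq_zero_of_isShiftIndexSet hfin.toFinset (hM ▸ hK) (coordExp v q)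
    (fun i m hm m' hm' => hdist.eq_of_coordExp_eq hq i ((hmem m).1 hm) ((hmem m').1 hm'))
    (fun m => φ (x + m) * conj (expFun η (x + m))) (fun j hj => by
      have h1 := hx j hj
      rw [sum_freqSet hA hM] at h1
      -- `e_{δj+η}(x+m) = e_{δj}(x) e_{δj}(m) e_η(x+m)`: the first factor does not depend on `m` and
      -- cancels, the second is the monomial, the third joins the unknown.
      simp only [latticeShift, expFun_add_left, expFun_add_right
        (Matrix.diagonal (fun l => v l / (q l : ℝ)) *ᵥ (fun l => (j l : ℝ))), map_mul,
        conj_expFun_diagonal v q j] at h1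
      have h2 : ∏ i, coordExp v q i (x i) ^ j i ≠ 0 := by
        rw [← conj_expFun_diagonal]
        exact conj_expFun_ne_zero _ _
      refine (mul_eq_zero.1 ?_).resolve_left h2
      rw [← h1, Finset.mul_sum]
      exact Finset.sum_congr rfl fun m _ => by ring) m ((hmem m).2 hm)
  exact (mul_eq_zero.1 key).resolve_right (conj_expFun_ne_zero _ _)

/-- Functions on `Ω` with the same data on the frequencies of a shift index set `K` agree at almost
every point whose frequency set has the shift index set `K`. -/
theorem ae_eq_of_datum_eq {d k : ℕ} {A : Matrix (Fin d) (Fin d) ℝ} (hA : A.det ≠ 0)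
    {Ω : Set (Fin d → ℝ)} (hΩ : IsMultiTile A Ω k) {v : Fin d → ℝ} {q : Fin d → ℕ}
    (hq : ∀ l, 0 < q l) (hadm : WeaklyAdmissible A Ω v q) (η : Fin d → ℝ)
    {K : Set (Fin d → ℕ)} {f g : (Fin d → ℝ) → ℂ} (hf : IntegrableOn f Ω) (hg : IntegrableOn g Ω)
    (h : ∀ l ∈ dataFrequencies A v q η K, datum Ω f l = datum Ω g l) :
    ∀ᵐ y, y ∈ Ω → ∀ x ∈ fundDomain A, y - x ∈ lattice A →
      IsShiftIndexSet d (freqSet A Ω x) K → f y = g y := by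
  have h0 := ae_freqSet_eq_zero hA hΩ hq hadm η (hf.sub hg) (K := K) fun l hl => by
    have h1 := sub_eq_zero.2 (h l hl)
    rw [datum, datum, ← integral_sub (integrable_mul_conj_expFun hf l)
      (integrable_mul_conj_expFun hg l)] at h1
    rw [datum, ← h1]
    simp only [Pi.sub_apply, sub_mul]
  filter_upwards [ae_of_sub_mem_lattice (A := A) (measurableSet_fundDomain hA) h0]
    with y hy hyΩ x hx hyx hK
  have hxy : x + (y - x) = y := by abel
  have := hy x hx hyx hK (y - x) ⟨hyx, by rwa [hxy]⟩
  rw [hxy] at this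
  exact sub_eq_zero.1 this

end MultiTile

/-! ### The recovery rule -/

/-- Let `Ω` be a weakly `(v, q)`-admissible `k`-tile for `Λ = A ℤ^d`. For almost every `x` in the
fundamental domain, shift index sets of `Λ_x` exist and have exactly `k` elements. For every `η` in
the dual lattice there is a recovery rule `R` such that for every `f ∈ L²(Ω)` and almost every
`y ∈ Ω`, the value `f y` is obtained by `R` from the data `⟨f, e_l⟩`, `l ∈ L`, where
`L = ⋃_{j ∈ K} (Λ* + δ j + η)` for any shift index set `K` of `Λ_x`, `x` being the representative
of `y` in the fundamental domain. -/
theorem theorem2 (d k : ℕ) (A : Matrix (Fin d) (Fin d) ℝ) (hA : A.det ≠ 0)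
    (Ω : Set (Fin d → ℝ)) (hΩ : MultiTile.IsMultiTile A Ω k)
    (v : Fin d → ℝ) (q : Fin d → ℕ) (hq : ∀ l, 0 < q l)
    (hadm : MultiTile.WeaklyAdmissible A Ω v q) :
    (∀ᵐ x ∂(volume.restrict (MultiTile.fundDomain A)),
      (∃ K, MultiTile.IsShiftIndexSet d (MultiTile.freqSet A Ω x) K) ∧
      ∀ K, MultiTile.IsShiftIndexSet d (MultiTile.freqSet A Ω x) K → K.encard = k) ∧
    ∀ η ∈ MultiTile.dualLattice A,
      ∃ R : (Fin d → ℝ) → (L : Set (Fin d → ℝ)) → (L → ℂ) → ℂ,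
        ∀ f : (Fin d → ℝ) → ℂ, MemLp f 2 (volume.restrict Ω) →
          ∀ᵐ y ∂(volume.restrict Ω), ∀ x ∈ MultiTile.fundDomain A, y - x ∈ MultiTile.lattice A →
            ∀ K, MultiTile.IsShiftIndexSet d (MultiTile.freqSet A Ω x) K →
              f y = R y (MultiTile.dataFrequencies A v q η K)
                (fun l => MultiTile.datum Ω f l) := by
  classical
  have hpart : ∀ᵐ x ∂(volume.restrict (MultiTile.fundDomain A)),
      (∃ K, MultiTile.IsShiftIndexSet d (MultiTile.freqSet A Ω x) K) ∧
      ∀ K, MultiTile.IsShiftIndexSet d (MultiTile.freqSet A Ω x) K → K.encard = k := by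
    filter_upwards [ae_restrict_of_ae hΩ.ae_encard_freqSet] with x hx
    have hfin : (MultiTile.freqSet A Ω x).Finite := by
      rw [← Set.encard_lt_top_iff, hx]
      exact ENat.natCast_lt_top _
    lift MultiTile.freqSet A Ω x to Finset (Fin d → ℝ) using hfin with M hM
    refine ⟨MultiTile.exists_isShiftIndexSet M, fun K hK => ?_⟩
    rw [MultiTile.encard_isShiftIndexSet M hK, ← hx, Set.encard_coe_eq_coe_finsetCard]
  refine ⟨hpart, fun η _ => ?_⟩
  have : IsFiniteMeasure (volume.restrict Ω) := ⟨by simpa using hΩ.finite⟩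
  let Q : (L : Set (Fin d → ℝ)) → (L → ℂ) → ((Fin d → ℝ) → ℂ) → Prop := fun L D h =>
    MemLp h 2 (volume.restrict Ω) ∧ ∀ l : L, MultiTile.datum Ω h l = D l
  -- The chosen function depends on `L` and the data only, not on `f`, `y` or `K`; the default 0 is
  -- never used for data that come from an `L²` function.
  let rec' : (L : Set (Fin d → ℝ)) → (L → ℂ) → (Fin d → ℝ) → ℂ := fun L D =>
    if H : ∃ h, Q L D h then H.choose else 0
  refine ⟨fun y L D => rec' L D y, fun f hf => ?_⟩
  have hrec : ∀ L, Q L (fun l => MultiTile.datum Ω f l)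
      (rec' L fun l => MultiTile.datum Ω f l) := fun L => by
    have H : ∃ h, Q L (fun l => MultiTile.datum Ω f l) h := ⟨f, hf, fun _ => rfl⟩
    simp only [rec', dif_pos H]
    exact H.choose_spec
  -- Finite index sets form a countable family, so `K` can be quantified inside; the cardinality `k`
  -- from `hpart` shows that no other `K` occur.
  have hall : ∀ᵐ y, ∀ K : Finset (Fin d → ℕ), y ∈ Ω → ∀ x ∈ MultiTile.fundDomain A,
      y - x ∈ MultiTile.lattice A → MultiTile.IsShiftIndexSet d (MultiTile.freqSet A Ω x) K →
      f y = rec' (MultiTile.dataFrequencies A v q η K) (fun l => MultiTile.datum Ω f l) y := by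
    rw [ae_all_iff]
    intro K
    have hK := hrec (MultiTile.dataFrequencies A v q η K)
    exact MultiTile.ae_eq_of_datum_eq hA hΩ hq hadm η (hf.integrable one_le_two)
      (hK.1.integrable one_le_two) fun l hl => (hK.2 ⟨l, hl⟩).symm
  filter_upwards [ae_restrict_mem₀ hΩ.nullMeasurable, ae_restrict_of_ae hall, ae_restrict_of_ae
    (MultiTile.ae_of_sub_mem_lattice (A := A) (MultiTile.measurableSet_fundDomain hA) hpart)]
    with y hyΩ hy hcard x hx hyx K hK
  have hfin : K.Finite := by
    rw [← Set.encard_lt_top_iff, (hcard x hx hyx).2 K hK]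
    exact ENat.natCast_lt_top _
  lift K to Finset (Fin d → ℕ) using hfin
  exact hy K hyΩ x hx hyx hK
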